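/- The language of urelement set theory has a binary relation symbol $\in$ and a unary predicate $\mathcal{A}$ ("is an urelement"); $x$ is a set if $\neg\mathcal{A}(x)$. The theory $\mathrm{ZFCU}_{\mathrm R}$ consists of: urelements have no members; Extensionality for sets; Foundation; Pairing; Union; Powerset (for every $x$ there is a set of all sets $z\subseteq x$); Infinity; the Separation scheme; the Replacement scheme $$\forall w,u\,\bigl(\forall x\in w\,\exists! y\,\varphi(x,y,u)\rightarrow\exists v\,\forall x\in w\,\exists y\in v\,\varphi(x,y,u)\bigr);$$ and AC (every set is well-orderable). It is not assumed that the urelements form a set. Collection is the scheme $$\forall w,u\,\bigl(\forall x\in w\,\exists y\,\varphi(x,y,u)\rightarrow\exists v\,\forall x\in w\,\exists y\in v\,\varphi(x,y,u)\bigr).$$ Let $U$ be a model of $\mathrm{ZFCU}_{\mathrm R}$, and let $F,x\in U$ be such that $U\models$ "$F$ is an ultrafilter on $x$". For $f,g\in U$ that are functions on $x$ in the sense of $U$, let $f=_F g$ mean $U\models\{y\in x: f(y)=g(y)\}\in F$, and let $[f]$ be the class of all $h\in U$ that are functions on $x$ in the sense of $U$ and satisfy $h=_F f$. The internal ultrapower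 $U/F$ is the structure whose elements are these classes $[f]$, with $[g]\mathrel{\hat\in}[f]$ iff $U\models\{y\in x: g(y)\in f(y)\}\in F$, and $\hat{\mathcal A}([f])$ iff $U\models\{y\in x:\mathcal A(f(y))\}\in F$. Łoś's theorem holds for $U/F$ if for every formula $\varphi$ of the language and all $[f_1],\dots,[f_n]\in U/F$, $$U/F\models\varphi([f_1],\dots,[f_n])\iff U\models\{y\in x:\varphi(f_1(y),\dots,f_n(y))\}\in F.$$ **Theorem.** Let $U$ be a model of $\mathrm{ZFCU}_{\mathrm R}$. The following are equivalent: 1. Łoś's theorem holds for all internal ultrapowers $U/F$ of $U$ (that is, for all $F,x\in U$ with $U\models$ "$F$ is an ultrafilter on $x$"). 2. $U\models$ Collection. -/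

import Mathlib

namespace Urelement

universe u

/-- The non-logical symbols of urelement set theory: a binary relation `∈` and
a unary predicate `𝒜` ("is an urelement"). -/
inductive Rel : ℕ → Type
  | mem : Rel 2
  | ure : Rel 1

/-- The first-order language of urelement set theory. -/
def lang : FirstOrder.Language.{0, 0} := ⟨fun _ => Empty, Rel⟩

section Axioms

variable {M : Type u} [lang.Structure M]

/-- `a ∈ b` in the sense of the structure `M`. -/
def Mem (a b : M) : Prop :=
  FirstOrder.Language.Structure.RelMap (L := lang) (M := M) (n := 2) Rel.mem ![a, b]

/-- `𝒜(a)` in the sense of the structure `M`. -/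
def Ure (a : M) : Prop :=
  FirstOrder.Language.Structure.RelMap (L := lang) (M := M) (n := 1) Rel.ure ![a]

/-- Sets are the objects that are not urelements. -/
def IsSet (a : M) : Prop := ¬ Ure a

/-- `a ⊆ b`. -/
def Sub (a b : M) : Prop := ∀ z : M, Mem z a → Mem z b

/-- `s = {a, b}`. -/
def IsUPair (s a b : M) : Prop := ∀ z : M, Mem z s ↔ z = a ∨ z = b

/-- `p` is the Kuratowski ordered pair `⟨a, b⟩ = {{a}, {a, b}}`. -/
def IsOPair (p a b : M) : Prop :=
  ∃ s t : M, IsUPair s a a ∧ IsUPair t a b ∧ IsUPair p s t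

/-- `⟨a, b⟩ ∈ r`. -/
def PairMem (r a b : M) : Prop := ∃ p : M, IsOPair p a b ∧ Mem p r

/-- In `M`, the set `r ⊆ x × x` is a (strict) well-ordering of `x`. -/
structure IsWellOrderOf (r x : M) : Prop where
  isSet : IsSet r
  subset : ∀ p : M, Mem p r → ∃ a b : M, Mem a x ∧ Mem b x ∧ IsOPair p a b
  irrefl : ∀ a : M, Mem a x → ¬ PairMem r a a
  trans : ∀ a b c : M, Mem a x → Mem b x → Mem c x →
    PairMem r a b → PairMem r b c → PairMem r a c
  total : ∀ a b : M, Mem a x → Mem b x → PairMem r a b ∨ a = b ∨ PairMem r b a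
  least : ∀ y : M, Sub y x → (∃ z : M, Mem z y) →
    ∃ m : M, Mem m y ∧ ∀ z : M, Mem z y → z = m ∨ PairMem r m z

variable (M)

/-- `M` is a model of `ZFCU_R`: the axioms of ZFC modified to allow urelements, with the
Replacement scheme (and not the Collection scheme). In the schemes, `φ` ranges over all formulas of
the language, and `u` over all finite tuples of parameters. -/
structure ModelsZFCUR : Prop where
  axiomA : ∀ x : M, Ure x → ¬ ∃ y : M, Mem y x
  extensionality : ∀ x y : M, IsSet x → IsSet y → (∀ z : M, Mem z y ↔ Mem z x) → x = y
  foundation : ∀ x : M, (∃ y : M, Mem y x) →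
    ∃ z : M, Mem z x ∧ ∀ w : M, ¬ (Mem w z ∧ Mem w x)
  pairing : ∀ x y : M, ∃ z : M, ∀ v : M, Mem v z ↔ v = x ∨ v = y
  union : ∀ x : M, ∃ y : M, ∀ z : M, Mem z y ↔ ∃ w : M, Mem w x ∧ Mem z w
  powerset : ∀ x : M, ∃ y : M, ∀ z : M, Mem z y ↔ IsSet z ∧ Sub z x
  separation : ∀ (n : ℕ) (φ : lang.Formula (Fin (n + 1))) (x : M) (u : Fin n → M),
    ∃ y : M, ∀ z : M, Mem z y ↔ Mem z x ∧ φ.Realize (Fin.cons z u : Fin (n + 1) → M)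
  infinity : ∃ s : M,
    (∃ y : M, Mem y s ∧ IsSet y ∧ ∀ z : M, ¬ Mem z y) ∧
    ∀ x : M, Mem x s → ∃ w : M, Mem w s ∧ ∀ z : M, Mem z w ↔ Mem z x ∨ z = x
  replacement : ∀ (n : ℕ) (φ : lang.Formula (Fin (n + 2))) (w : M) (u : Fin n → M),
    (∀ x : M, Mem x w →
      ∃! y : M, φ.Realize (Fin.cons x (Fin.cons y u : Fin (n + 1) → M) : Fin (n + 2) → M)) →
    ∃ v : M, ∀ x : M, Mem x w → ∃ y : M, Mem y v ∧
      φ.Realize (Fin.cons x (Fin.cons y u : Fin (n + 1) → M) : Fin (n + 2) → M)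
  choice : ∀ x : M, IsSet x → ∃ r : M, IsWellOrderOf r x

/-- `M` satisfies the Collection scheme. -/
def SatisfiesCollection : Prop :=
  ∀ (n : ℕ) (φ : lang.Formula (Fin (n + 2))) (w : M) (u : Fin n → M),
    (∀ x : M, Mem x w →
      ∃ y : M, φ.Realize (Fin.cons x (Fin.cons y u : Fin (n + 1) → M) : Fin (n + 2) → M)) →
    ∃ v : M, ∀ x : M, Mem x w → ∃ y : M, Mem y v ∧
      φ.Realize (Fin.cons x (Fin.cons y u : Fin (n + 1) → M) : Fin (n + 2) → M)

end Axioms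

section Ultrapower

variable {M : Type u} [lang.Structure M]

/-- `M ⊨ (F is an ultrafilter on x)`. -/
structure IsUltrafilterOn (F x : M) : Prop where
  isSet_base : IsSet x
  isSet : IsSet F
  subset : ∀ s : M, Mem s F → IsSet s ∧ Sub s x
  base_mem : Mem x F
  nonempty : ∀ s : M, Mem s F → ∃ z : M, Mem z s
  inter : ∀ s t : M, Mem s F → Mem t F →
    ∃ i : M, Mem i F ∧ ∀ z : M, Mem z i ↔ Mem z s ∧ Mem z t
  upward : ∀ s t : M, Mem s F → IsSet t → Sub s t → Sub t x → Mem t F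
  ultra : ∀ s : M, IsSet s → Sub s x →
    Mem s F ∨ ∃ c : M, Mem c F ∧ ∀ z : M, Mem z c ↔ Mem z x ∧ ¬ Mem z s

/-- `M ⊨ (f is a function on x)`, i.e. a function with domain `x` (and arbitrary values). -/
structure IsFunctionOn (f x : M) : Prop where
  isSet : IsSet f
  rel : ∀ p : M, Mem p f → ∃ a b : M, Mem a x ∧ IsOPair p a b
  total : ∀ a : M, Mem a x → ∃! b : M, PairMem f a b

/-- `{y ∈ x : P y} ∈ F`: the subset of `x` cut out by `P` exists in `M` and belongs to `F`. -/
def AlmostAll (F x : M) (P : M → Prop) : Prop :=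
  ∃ s : M, Mem s F ∧ ∀ y : M, Mem y s ↔ Mem y x ∧ P y

/-- `f =_F g`, i.e. `{y ∈ x : f(y) = g(y)} ∈ F`. Here `PairMem f y a` says `f(y) = a`. -/
def EqMod (F x f g : M) : Prop :=
  AlmostAll F x fun y => ∃ a b : M, PairMem f y a ∧ PairMem g y b ∧ a = b

/-- The class `[f]` of the functions `h` on `x` such that `h =_F f`. -/
def eqClass (F x f : M) : Set M := {h | IsFunctionOn h x ∧ EqMod F x h f}

/-- The universe `{[f] : f is a function on x}` of the internal ultrapower `M/F`. -/
def Ultrapower (F x : M) : Type u := {c : Set M // ∃ f : M, IsFunctionOn f x ∧ c = eqClass F x f}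

/-- `[f]`, as an element of the internal ultrapower. -/
def Ultrapower.mk (F x f : M) (hf : IsFunctionOn f x) : Ultrapower F x :=
  ⟨eqClass F x f, f, hf, rfl⟩

/-- `c ∈̂ d`: for some `g`, `f` with `c = [g]`, `d = [f]`, one has `{y ∈ x : g(y) ∈ f(y)} ∈ F`. -/
def Ultrapower.MemHat {F x : M} (c d : Ultrapower F x) : Prop :=
  ∃ (g f : M) (hg : IsFunctionOn g x) (hf : IsFunctionOn f x),
    c = Ultrapower.mk F x g hg ∧ d = Ultrapower.mk F x f hf ∧
    AlmostAll F x fun y => ∃ a b : M, PairMem g y a ∧ PairMem f y b ∧ Mem a b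

/-- `𝒜̂(c)`: for some `f` with `c = [f]`, one has `{y ∈ x : 𝒜(f(y))} ∈ F`. -/
def Ultrapower.UreHat {F x : M} (c : Ultrapower F x) : Prop :=
  ∃ (f : M) (hf : IsFunctionOn f x), c = Ultrapower.mk F x f hf ∧
    AlmostAll F x fun y => ∃ a : M, PairMem f y a ∧ Ure a

/-- The internal ultrapower `⟨M/F, ∈̂, 𝒜̂⟩`, as a structure for the language. -/
instance Ultrapower.instStructure (F x : M) : lang.Structure (Ultrapower F x) where
  funMap := fun f _ => Empty.elim f
  RelMap := fun {_} r =>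
    match r with
    | Rel.mem => fun v => Ultrapower.MemHat (v 0) (v 1)
    | Rel.ure => fun v => Ultrapower.UreHat (v 0)

/-- Łoś's theorem holds for `M/F`: for all formulas `φ` and functions `f₁, …, fₙ` on `x`,
`M/F ⊨ φ([f₁], …, [fₙ])` if and only if `{y ∈ x : φ(f₁(y), …, fₙ(y))} ∈ F` in `M`. -/
def LosHolds (F x : M) : Prop :=
  ∀ (n : ℕ) (φ : lang.Formula (Fin n)) (f : Fin n → M) (hf : ∀ i, IsFunctionOn (f i) x),
    φ.Realize (fun i => Ultrapower.mk F x (f i) (hf i)) ↔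
      AlmostAll F x fun y => ∃ v : Fin n → M, (∀ i, PairMem (f i) y (v i)) ∧ φ.Realize v

end Ultrapower

end Urelement

namespace Urelement

universe u

open FirstOrder

/-! Collection implies Łoś: induct on formulas. Atomic formulas, implication and falsum need only
the ultrafilter laws and Separation. At a universal quantifier one needs a function in the model
that picks a counterexample at every index that has one. Collection bounds the counterexamples by a
set, AC well-orders it, and Replacement turns "the least counterexample at `y`" into a function
(`SatisfiesCollection.exists_selector`).

Łoś implies Collection: suppose `φ` is total on `w` but its witnesses cannot be collected. The
subsets of `w` over which they can be collected form a proper ideal, and inside the model some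
ultrafilter `F` on `w` avoids it (`IsIdealOver.exists_ultrafilter`). Łoś for `∃ y, φ`, taken at the
class of the identity and the classes of constant functions, gives a witness `[g]` in the
ultrapower. Łoś for `φ` then says that `g x` is a witness for `F`-many `x`, so the range of `g`
collects witnesses over a member of `F`, a contradiction (`LosHolds.exists_collecting`).

The axiom schemes speak of formulas, while the arguments use Lean predicates. The classes `Dfn`,
`Tm` and `Pr` let instance search find the formulas; `Dfn.exists_formula` passes back to finite
tuples of parameters. -/

/-- A type `E` of finite tuples of elements of `M`: every `e : E` is an assignment of the variables
in `idx`, among which there is a name for each element of `M`. -/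
class Ctx (M : Type u) (E : Type u) where
  idx : Type u
  enc : E → idx → M
  const : M → idx
  enc_const : ∀ e m, enc e (const m) = m

instance Ctx.base (M : Type u) : Ctx M M where
  idx := M ⊕ Unit
  enc a := Sum.elim id fun _ => a
  const := Sum.inl
  enc_const _ _ := rfl

instance Ctx.prod (M E : Type u) [Ctx M E] : Ctx M (E × M) where
  idx := Ctx.idx M E ⊕ Unit
  enc p := Sum.elim (Ctx.enc p.1) fun _ => p.2
  const m := Sum.inl (Ctx.const (E := E) m)
  enc_const p m := Ctx.enc_const p.1 m

/-- `P` is definable with parameters from `M`. -/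
class Dfn (M : Type u) [lang.Structure M] {E : Type u} [Ctx M E] (P : E → Prop) : Prop where
  out : ∃ φ : lang.Formula (Ctx.idx M E), ∀ e, φ.Realize (Ctx.enc e) ↔ P e

/-- `q` maps variables to variables. -/
class Pr (M : Type u) {E E' : Type u} [Ctx M E] [Ctx M E'] (q : E → E') : Prop where
  out : ∀ i : Ctx.idx M E', ∃ j : Ctx.idx M E, ∀ e, Ctx.enc (q e) i = Ctx.enc e j

/-- `t` has a definable graph. -/
class Tm (M : Type u) [lang.Structure M] {E : Type u} [Ctx M E] (t : E → M) : Prop where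
  out : Dfn M fun p : E × M => p.2 = t p.1

/-! ### Closure properties of definability with parameters -/

section Definability

variable {M : Type u} {E E' : Type u} [Ctx M E] [Ctx M E']

instance Pr.id : Pr M fun e : E => e := ⟨fun i => ⟨i, fun _ => rfl⟩⟩

instance Pr.fst {q : E → E' × M} [hq : Pr M q] : Pr M fun e => (q e).1 :=
  ⟨fun i => hq.out (Sum.inl i)⟩

theorem Pr.exists_snd (q : E → E' × M) [hq : Pr M q] :
    ∃ j : Ctx.idx M E, ∀ e, (q e).2 = Ctx.enc e j :=
  hq.out (Sum.inr ())

theorem Pr.exists_base (q : E → M) [hq : Pr M q] :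
    ∃ j : Ctx.idx M E, ∀ e, q e = Ctx.enc e j :=
  hq.out (Sum.inr ())

theorem Pr.mk_prod {q : E → E'} [hq : Pr M q] {t : E → M}
    (ht : ∃ j : Ctx.idx M E, ∀ e, t e = Ctx.enc e j) : Pr M fun e => (q e, t e) :=
  ⟨fun i => i.casesOn hq.out fun _ => ht⟩

theorem Pr.mk_base {t : E → M} (ht : ∃ j : Ctx.idx M E, ∀ e, t e = Ctx.enc e j) : Pr M t :=
  ⟨fun i => i.casesOn (fun m => ⟨Ctx.const (E := E) m, fun e => (Ctx.enc_const e m).symm⟩) fun _ => ht⟩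

theorem Pr.pair (q : E → E') (t : E → M) [Pr M q] [Pr M t] : Pr M fun e => (q e, t e) :=
  Pr.mk_prod (Pr.exists_base t)

instance Pr.snd {q : E → E' × M} [Pr M q] : Pr M fun e => (q e).2 := Pr.mk_base (Pr.exists_snd q)

variable [lang.Structure M]

theorem Dfn.congr (P : E → Prop) [hP : Dfn M P] {Q : E → Prop} (h : ∀ e, P e ↔ Q e) :
    Dfn M Q := by
  obtain rfl : P = Q := funext fun e => propext (h e)
  exact hP

theorem Dfn.comp {P : E' → Prop} (hP : Dfn M P) (q : E → E') [hq : Pr M q] :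
    Dfn M fun e => P (q e) := by
  obtain ⟨φ, hφ⟩ := hP.out
  choose j hj using hq.out
  refine ⟨φ.relabel j, fun e => ?_⟩
  rw [Language.Formula.realize_relabel, ← hφ]
  exact iff_of_eq (congrArg _ (funext fun i => (hj i e).symm))

theorem Dfn.eq_of_var {s t : E → M} (hs : ∃ j : Ctx.idx M E, ∀ e, s e = Ctx.enc e j)
    (ht : ∃ j : Ctx.idx M E, ∀ e, t e = Ctx.enc e j) : Dfn M fun e => s e = t e := by
  obtain ⟨i, hi⟩ := hs
  obtain ⟨j, hj⟩ := ht
  refine ⟨Language.Term.equal (Language.Term.var i) (Language.Term.var j), fun e => ?_⟩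
  rw [Language.Formula.realize_equal, hi, hj]
  rfl

instance Tm.const (c : M) : Tm M fun _ : E => c :=
  ⟨Dfn.eq_of_var (Pr.exists_snd _) ⟨Ctx.const (E := E × M) c, fun e => (Ctx.enc_const e c).symm⟩⟩

instance Tm.var (q : E → M) [Pr M q] : Tm M q := by
  obtain ⟨j, hj⟩ := Pr.exists_base q
  exact ⟨Dfn.eq_of_var (Pr.exists_snd _) ⟨Sum.inl j, fun e => hj e.1⟩⟩

/-- The truth value of `p` does not depend on the assignment, so `⊤` or `⊥` defines it. -/
instance Dfn.const (p : Prop) : Dfn M fun _ : E => p := by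
  by_cases hp : p
  · exact ⟨⊤, fun e => by simp [hp]⟩
  · exact ⟨⊥, fun e => by simp [hp]⟩

instance Dfn.not {P : E → Prop} [hP : Dfn M P] : Dfn M fun e => ¬ P e := by
  obtain ⟨φ, hφ⟩ := hP.out
  exact ⟨φ.not, fun e => by rw [Language.Formula.realize_not, hφ]⟩

instance Dfn.and {P Q : E → Prop} [hP : Dfn M P] [hQ : Dfn M Q] : Dfn M fun e => P e ∧ Q e := by
  obtain ⟨φ, hφ⟩ := hP.out
  obtain ⟨ψ, hψ⟩ := hQ.out
  exact ⟨φ ⊓ ψ, fun e => by rw [Language.Formula.realize_inf, hφ, hψ]⟩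

instance Dfn.imp {P Q : E → Prop} [hP : Dfn M P] [hQ : Dfn M Q] : Dfn M fun e => P e → Q e :=
  Dfn.congr (fun e => ¬ (P e ∧ ¬ Q e)) fun e => by tauto

instance Dfn.or {P Q : E → Prop} [hP : Dfn M P] [hQ : Dfn M Q] : Dfn M fun e => P e ∨ Q e :=
  Dfn.congr (fun e => ¬ (¬ P e ∧ ¬ Q e)) fun e => by tauto

instance Dfn.iff {P Q : E → Prop} [hP : Dfn M P] [hQ : Dfn M Q] : Dfn M fun e => P e ↔ Q e :=
  Dfn.congr (fun e => (P e → Q e) ∧ (Q e → P e)) fun e => by tauto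

instance Dfn.ex {P : E → M → Prop} [hP : Dfn M fun p : E × M => P p.1 p.2] :
    Dfn M fun e => ∃ a, P e a := by
  obtain ⟨φ, hφ⟩ := hP.out
  refine ⟨Language.Formula.iExs (α := Ctx.idx M E) Unit φ, fun e => ?_⟩
  rw [Language.Formula.realize_iExs]
  exact ⟨fun ⟨i, hi⟩ => ⟨i (), (hφ (e, i ())).1 hi⟩, fun ⟨a, ha⟩ => ⟨fun _ => a, (hφ (e, a)).2 ha⟩⟩

instance Dfn.all {P : E → M → Prop} [hP : Dfn M fun p : E × M => P p.1 p.2] :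
    Dfn M fun e => ∀ a, P e a :=
  Dfn.congr (fun e => ¬ ∃ a, ¬ P e a) fun e => by
    simp only [not_exists, not_not]

/-- The language has no function symbols, so a term is substituted by quantifying over its value and
using its graph. -/
theorem Dfn.comp₁ {P : M → Prop} (hP : Dfn M P) {t : E → M} (ht : Tm M t) :
    Dfn M fun e => P (t e) := by
  have := ht.out
  have : Dfn M fun p : E × M => P p.2 := hP.comp fun p : E × M => p.2
  exact Dfn.congr (fun e => ∃ a, a = t e ∧ P a) fun e => by simp

theorem Dfn.comp₂ {P : M → M → Prop} (hP : Dfn M fun p : M × M => P p.1 p.2) {s t : E → M}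
    (hs : Tm M s) (ht : Tm M t) : Dfn M fun e => P (s e) (t e) := by
  have h₁ : Dfn M fun p : (E × M) × M => p.1.2 = s p.1.1 := hs.out.comp fun p : (E × M) × M => p.1
  have h₂ : Dfn M fun p : (E × M) × M => p.2 = t p.1.1 :=
    ht.out.comp _ (hq := Pr.pair (fun p : (E × M) × M => p.1.1) fun p => p.2)
  have h₃ : Dfn M fun p : (E × M) × M => P p.1.2 p.2 :=
    hP.comp _ (hq := Pr.pair (fun p : (E × M) × M => p.1.2) fun p => p.2)
  exact Dfn.congr (fun e => ∃ a b, a = s e ∧ b = t e ∧ P a b)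
    fun e => by simp

theorem Dfn.comp₃ {P : M → M → M → Prop} (hP : Dfn M fun p : (M × M) × M => P p.1.1 p.1.2 p.2)
    {r s t : E → M} (hr : Tm M r) (hs : Tm M s) (ht : Tm M t) :
    Dfn M fun e => P (r e) (s e) (t e) := by
  have h₀ : Dfn M fun p : ((E × M) × M) × M => p.1.1.2 = r p.1.1.1 :=
    hr.out.comp fun p : ((E × M) × M) × M => p.1.1
  have h₁ : Dfn M fun p : ((E × M) × M) × M => p.1.2 = s p.1.1.1 :=
    hs.out.comp _ (hq := Pr.pair (fun p : ((E × M) × M) × M => p.1.1.1) fun p => p.1.2)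
  have h₂ : Dfn M fun p : ((E × M) × M) × M => p.2 = t p.1.1.1 :=
    ht.out.comp _ (hq := Pr.pair (fun p : ((E × M) × M) × M => p.1.1.1) fun p => p.2)
  have h₃ : Dfn M fun p : ((E × M) × M) × M => P p.1.1.2 p.1.2 p.2 :=
    hP.comp _ (hq := have := Pr.pair (fun p : ((E × M) × M) × M => p.1.1.2) fun p => p.1.2
      Pr.pair (fun p : ((E × M) × M) × M => (p.1.1.2, p.1.2)) fun p => p.2)
  exact Dfn.congr (fun e => ∃ a b c, a = r e ∧ b = s e ∧ c = t e ∧ P a b c)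
    fun e => by simp

instance Dfn.eq {s t : E → M} [hs : Tm M s] [ht : Tm M t] : Dfn M fun e => s e = t e :=
  Dfn.comp₂ (Dfn.eq_of_var (Pr.exists_base _) (Pr.exists_snd _)) hs ht

instance Dfn.mem {s t : E → M} [hs : Tm M s] [ht : Tm M t] : Dfn M fun e => Mem (s e) (t e) := by
  refine Dfn.comp₂ ⟨Language.Relations.formula₂ (L := lang) (Rel.mem : lang.Relations 2)
    (Language.Term.var (Sum.inl (Sum.inr ()))) (Language.Term.var (Sum.inr ())), fun e => ?_⟩ hs ht
  exact Language.Formula.realize_rel₂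

instance Dfn.ure {t : E → M} [ht : Tm M t] : Dfn M fun e => Ure (t e) := by
  refine Dfn.comp₁ ⟨Language.Relations.formula₁ (L := lang) (Rel.ure : lang.Relations 1)
    (Language.Term.var (Sum.inr ())), fun e => ?_⟩ ht
  exact Language.Formula.realize_rel₁

instance Dfn.isSet {t : E → M} [Tm M t] : Dfn M fun e => IsSet (t e) :=
  inferInstanceAs (Dfn M fun e => ¬ Ure (t e))

instance Dfn.sub {s t : E → M} [hs : Tm M s] [ht : Tm M t] : Dfn M fun e => Sub (s e) (t e) :=
  Dfn.comp₂ (inferInstanceAs (Dfn M fun p : M × M => ∀ z, Mem z p.1 → Mem z p.2)) hs ht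

instance Dfn.isUPair {r s t : E → M} [hr : Tm M r] [hs : Tm M s] [ht : Tm M t] :
    Dfn M fun e => IsUPair (r e) (s e) (t e) :=
  Dfn.comp₃ (inferInstanceAs
    (Dfn M fun p : (M × M) × M => ∀ z, Mem z p.1.1 ↔ z = p.1.2 ∨ z = p.2)) hr hs ht

instance Dfn.isOPair {r s t : E → M} [hr : Tm M r] [hs : Tm M s] [ht : Tm M t] :
    Dfn M fun e => IsOPair (r e) (s e) (t e) :=
  Dfn.comp₃ (inferInstanceAs (Dfn M fun p : (M × M) × M =>
    ∃ s t : M, IsUPair s p.1.2 p.1.2 ∧ IsUPair t p.1.2 p.2 ∧ IsUPair p.1.1 s t)) hr hs ht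

instance Dfn.pairMem {r s t : E → M} [hr : Tm M r] [hs : Tm M s] [ht : Tm M t] :
    Dfn M fun e => PairMem (r e) (s e) (t e) :=
  Dfn.comp₃ (inferInstanceAs (Dfn M fun p : (M × M) × M =>
    ∃ q : M, IsOPair q p.1.2 p.2 ∧ Mem q p.1.1)) hr hs ht

instance Tm.comp_fst {t : E → M} [ht : Tm M t] : Tm M fun p : E × M => t p.1 :=
  ⟨ht.out.comp _ (hq := Pr.pair (fun p : (E × M) × M => p.1.1) fun p => p.2)⟩

/-- Serves formulas that are variables of the metatheory, which instance search cannot decompose. A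
quantifier enlarges the context to `E × M`, so the induction must generalize `E`. -/
theorem Dfn.boundedFormula_realize {α : Type} {k : ℕ} (φ : lang.BoundedFormula α k)
    {E : Type u} [Ctx M E] (t : E → α → M) (xs : E → Fin k → M) (ht : ∀ i, Tm M fun e => t e i)
    (hx : ∀ i, Tm M fun e => xs e i) : Dfn M fun e => φ.Realize (t e) (xs e) := by
  have hterm : ∀ (k : ℕ) (E : Type u) (_ : Ctx M E) (t : E → α → M) (xs : E → Fin k → M)
      (_ : ∀ i, Tm M fun e => t e i) (_ : ∀ i, Tm M fun e => xs e i)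
      (τ : lang.Term (α ⊕ Fin k)), Tm M fun e => τ.realize (Sum.elim (t e) (xs e)) := by
    intro k E _ t xs ht hx τ
    rcases τ with i | f
    · rcases i with i | i
      exacts [ht i, hx i]
    · exact f.elim
  induction φ generalizing E with
  | falsum => exact Dfn.const False
  | equal t₁ t₂ =>
    have := hterm _ E _ t xs ht hx t₁
    have := hterm _ E _ t xs ht hx t₂
    exact Dfn.eq (M := M)
  | rel R ts =>
    cases R with
    | mem =>
      have h0 := hterm _ E _ t xs ht hx (ts 0)
      have h1 := hterm _ E _ t xs ht hx (ts 1)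
      refine Dfn.congr _ (hP := Dfn.mem (M := M) (hs := h0) (ht := h1)) fun e => ?_
      refine iff_of_eq (congrArg _ (funext fun i => ?_))
      fin_cases i <;> rfl
    | ure =>
      have h0 := hterm _ E _ t xs ht hx (ts 0)
      refine Dfn.congr _ (hP := Dfn.ure (M := M) (ht := h0)) fun e => ?_
      refine iff_of_eq (congrArg _ (funext fun i => ?_))
      fin_cases i; rfl
  | imp φ ψ h₁ h₂ =>
    have := h₁ t xs ht hx
    have := h₂ t xs ht hx
    exact Dfn.imp (M := M)
  | all φ h =>
    have := h (E := E × M) (fun p => t p.1) (fun p => Fin.snoc (xs p.1) p.2)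
      (fun i => Tm.comp_fst (ht := ht i)) fun i => by
        refine Fin.lastCases ?_ (fun j => ?_) i
        · simp only [Fin.snoc_last]; infer_instance
        · simp only [Fin.snoc_castSucc]; exact Tm.comp_fst (ht := hx j)
    exact Dfn.all (M := M)

/-- A relation definable with parameters is given by a formula and a tuple of parameters. -/
theorem Dfn.exists_formula {R : M → M → Prop} (hR : Dfn M fun p : M × M => R p.1 p.2) :
    ∃ (n : ℕ) (φ : lang.Formula (Fin (n + 2))) (u : Fin n → M), ∀ x y,
      φ.Realize (Fin.cons x (Fin.cons y u : Fin (n + 1) → M) : Fin (n + 2) → M) ↔ R x y := by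
  classical
  -- An empty `M` offers no filler value for unused entries of `u`.
  rcases isEmpty_or_nonempty M with hM | hM
  · exact ⟨0, ⊥, finZeroElim, fun x => isEmptyElim x⟩
  obtain ⟨φ, hφ⟩ := hR.out
  let β := φ.freeVarFinset
  let e : β ≃ Fin β.card := β.equivFin
  -- Every free variable gets an entry of `u`; the entries that belong to `x` and `y` are never
  -- read.
  let g : β → Fin (β.card + 2) := fun b => match b.1 with
    | Sum.inl (Sum.inl _) => (e b).succ.succ
    | Sum.inl (Sum.inr _) => 0
    | Sum.inr _ => 1
  have hpar : ∃ u : Fin β.card → M, ∀ (b : β) (m : M), b.1 = Sum.inl (Sum.inl m) → u (e b) = m := by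
    have : ∀ b : β, ∃ a : M, ∀ m : M, b.1 = Sum.inl (Sum.inl m) → a = m := by
      rintro ⟨b, hb⟩
      by_cases h : ∃ m : M, b = Sum.inl (Sum.inl m)
      · obtain ⟨m, rfl⟩ := h
        exact ⟨m, fun m' h => Sum.inl.inj (Sum.inl.inj h)⟩
      · exact ⟨Classical.arbitrary M, fun m hm => (h ⟨m, hm⟩).elim⟩
    choose u hu using this
    exact ⟨u ∘ e.symm, fun b m h => by simpa using hu b m h⟩
  obtain ⟨u, hu⟩ := hpar
  refine ⟨β.card, (Language.BoundedFormula.restrictFreeVar φ g), u, fun x y => ?_⟩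
  rw [← hφ (x, y)]
  refine Language.BoundedFormula.realize_restrictFreeVar (φ := φ) (Ctx.enc (x, y)) ?_
  rintro ⟨b, hb⟩
  rcases b with (m | _) | _
  · exact hu ⟨_, hb⟩ m rfl
  · rfl
  · rfl

end Definability

/-! ### Elementary set theory inside the model -/

section SetTheory

variable {M : Type u} [lang.Structure M]

theorem isSet_of_mem (hU : ModelsZFCUR M) {x y : M} (h : Mem y x) : IsSet x :=
  fun hx => hU.axiomA x hx ⟨y, h⟩

theorem exists_empty (hU : ModelsZFCUR M) : ∃ e : M, IsSet e ∧ ∀ z, ¬ Mem z e := by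
  obtain ⟨s, ⟨y, -, hy⟩, -⟩ := hU.infinity
  exact ⟨y, hy⟩

theorem exists_sep (hU : ModelsZFCUR M) (P : M → Prop) [hP : Dfn M P] (x : M) :
    ∃ y, IsSet y ∧ ∀ z, Mem z y ↔ Mem z x ∧ P z := by
  have hR : Dfn M fun p : M × M => P p.1 := hP.comp fun p : M × M => p.1
  obtain ⟨n, φ, u, hφ⟩ := Dfn.exists_formula (R := fun z _ => P z) hR
  -- The second variable of `φ` is a dummy; `x` fills it.
  obtain ⟨y, hy⟩ := hU.separation (n + 1) φ x (Fin.cons x u)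
  simp only [hφ] at hy
  -- If nothing is separated, `y` may be an urelement; the empty set replaces it.
  by_cases h : ∃ z, Mem z y
  · obtain ⟨z, hz⟩ := h
    exact ⟨y, isSet_of_mem hU hz, hy⟩
  · obtain ⟨e, he, he'⟩ := exists_empty hU
    exact ⟨e, he, fun z => ⟨fun hz => (he' z hz).elim, fun hz => (h ⟨z, (hy z).2 hz⟩).elim⟩⟩

theorem IsOPair.inj {p a b c d : M} (hp : IsOPair p a b) (hq : IsOPair p c d) :
    a = c ∧ b = d := by
  obtain ⟨s, t, hs, ht, hp⟩ := hp
  obtain ⟨s', t', hs', ht', hq⟩ := hq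
  have h1 := (hq s).1 ((hp s).2 (Or.inl rfl))
  have h2 := (hq t).1 ((hp t).2 (Or.inr rfl))
  have h3 := (hp s').1 ((hq s').2 (Or.inl rfl))
  have h4 := (hp t').1 ((hq t').2 (Or.inr rfl))
  have := hs a
  have := hs' c
  have := ht a
  have := ht b
  have := ht' c
  have := ht' d
  have := hs c
  have := hs d
  have := hs' a
  have := hs' b
  have := ht c
  have := ht d
  have := ht' a
  have := ht' b
  grind

theorem exists_oPair (hU : ModelsZFCUR M) (a b : M) : ∃ p, IsOPair p a b := by
  obtain ⟨s, hs⟩ := hU.pairing a a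
  obtain ⟨t, ht⟩ := hU.pairing a b
  obtain ⟨p, hp⟩ := hU.pairing s t
  exact ⟨p, s, t, hs, ht, hp⟩

theorem exists_union₂ (hU : ModelsZFCUR M) (a b : M) :
    ∃ c, IsSet c ∧ ∀ z, Mem z c ↔ Mem z a ∨ Mem z b := by
  obtain ⟨p, hp⟩ := hU.pairing a b
  obtain ⟨y, hy⟩ := hU.union p
  obtain ⟨c, hc, hc'⟩ := exists_sep hU (fun _ => True) y
  exact ⟨c, hc, fun z => by simp [hc', hy, hp]⟩

/-- Kuratowski pairs over `x ∪ v` lie in its double powerset. -/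
theorem exists_prod_bound (hU : ModelsZFCUR M) (x v : M) :
    ∃ X, ∀ p a b, Mem a x → Mem b v → IsOPair p a b → Mem p X := by
  obtain ⟨y, -, hy⟩ := exists_union₂ hU x v
  obtain ⟨Y, hY⟩ := hU.powerset y
  obtain ⟨X, hX⟩ := hU.powerset Y
  refine ⟨X, fun p a b ha hb ⟨s, t, hs, ht, hp⟩ => ?_⟩
  have ha' := (hy a).2 (Or.inl ha)
  have hb' := (hy b).2 (Or.inr hb)
  refine (hX p).2 ⟨isSet_of_mem hU ((hp s).2 (Or.inl rfl)), fun z hz => (hY z).2 ?_⟩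
  rcases (hp z).1 hz with rfl | rfl
  · exact ⟨isSet_of_mem hU ((hs a).2 (Or.inl rfl)), fun w hw => by
      rcases (hs w).1 hw with rfl | rfl <;> assumption⟩
  · exact ⟨isSet_of_mem hU ((ht a).2 (Or.inl rfl)), fun w hw => by
      rcases (ht w).1 hw with rfl | rfl <;> assumption⟩

theorem exists_collecting_of_existsUnique (hU : ModelsZFCUR M) {R : M → M → Prop}
    (hR : Dfn M fun p : M × M => R p.1 p.2) {w : M} (h : ∀ x, Mem x w → ∃! y, R x y) :
    ∃ v, ∀ x, Mem x w → ∃ y, Mem y v ∧ R x y := by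
  obtain ⟨n, φ, u, hφ⟩ := Dfn.exists_formula hR
  simpa only [hφ] using hU.replacement n φ w u (by simpa only [hφ] using h)

theorem SatisfiesCollection.exists_collecting (hC : SatisfiesCollection M) {R : M → M → Prop}
    (hR : Dfn M fun p : M × M => R p.1 p.2) {w : M} (h : ∀ x, Mem x w → ∃ y, R x y) :
    ∃ v, ∀ x, Mem x w → ∃ y, Mem y v ∧ R x y := by
  obtain ⟨n, φ, u, hφ⟩ := Dfn.exists_formula hR
  simpa only [hφ] using hC n φ w u (by simpa only [hφ] using h)

/-- A definable class function on a set is a function. -/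
theorem exists_function (hU : ModelsZFCUR M) {R : M → M → Prop}
    (hR : Dfn M fun p : M × M => R p.1 p.2) {x : M} (h : ∀ a, Mem a x → ∃! b, R a b) :
    ∃ f, IsFunctionOn f x ∧ ∀ a b, Mem a x → (PairMem f a b ↔ R a b) := by
  obtain ⟨v, hv⟩ := exists_collecting_of_existsUnique hU hR h
  obtain ⟨X, hX⟩ := exists_prod_bound hU x v
  have : Dfn M fun p : (M × M) × M => R p.1.2 p.2 :=
    hR.comp _ (hq := Pr.pair (fun p : (M × M) × M => p.1.2) fun p => p.2)
  obtain ⟨f, hf, hf'⟩ := exists_sep hU (fun p => ∃ a b, Mem a x ∧ R a b ∧ IsOPair p a b) X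
  have key : ∀ a b, Mem a x → (PairMem f a b ↔ R a b) := by
    intro a b ha
    constructor
    · rintro ⟨p, hp, hpf⟩
      obtain ⟨-, a', b', -, hR', hp'⟩ := (hf' p).1 hpf
      obtain ⟨rfl, rfl⟩ := hp.inj hp'
      exact hR'
    · intro hab
      obtain ⟨p, hp⟩ := exists_oPair hU a b
      obtain ⟨b', hb', hab'⟩ := hv a ha
      obtain rfl := (h a ha).unique hab hab'
      exact ⟨p, hp, (hf' p).2 ⟨hX p a b ha hb' hp, a, b, ha, hab, hp⟩⟩
  refine ⟨f, ⟨hf, fun p hp => ?_, fun a ha => ?_⟩, key⟩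
  · obtain ⟨-, a, b, ha, -, hp⟩ := (hf' p).1 hp
    exact ⟨a, b, ha, hp⟩
  · simpa only [key a _ ha] using h a ha

/-- The range of a function. -/
theorem exists_range (hU : ModelsZFCUR M) (f : M) :
    ∃ v, ∀ a b, PairMem f a b → Mem b v := by
  obtain ⟨y, hy⟩ := hU.union f
  obtain ⟨v, hv⟩ := hU.union y
  refine ⟨v, fun a b ⟨p, ⟨s, t, hs, ht, hp⟩, hpf⟩ => (hv b).2 ⟨t, (hy t).2 ⟨p, hpf, ?_⟩, ?_⟩⟩
  · exact (hp t).2 (Or.inr rfl)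
  · exact (ht b).2 (Or.inr rfl)

/-- The order is well-founded only for sets of the model; definability of `P` makes the
counterexamples such a set. -/
theorem IsWellOrderOf.induction (hU : ModelsZFCUR M) {r X : M} (hr : IsWellOrderOf r X)
    (P : M → Prop) [Dfn M P]
    (h : ∀ a, Mem a X → (∀ b, Mem b X → PairMem r b a → P b) → P a) :
    ∀ a, Mem a X → P a := by
  by_contra! hc
  obtain ⟨a, haX, ha⟩ := hc
  obtain ⟨y, -, hy⟩ := exists_sep hU (fun z => ¬ P z) X
  obtain ⟨m, hm, hm'⟩ := hr.least y (fun z hz => ((hy z).1 hz).1) ⟨a, (hy a).2 ⟨haX, ha⟩⟩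
  refine ((hy m).1 hm).2 (h m ((hy m).1 hm).1 fun b hb hbm => ?_)
  by_contra hPb
  have hmX := ((hy m).1 hm).1
  rcases hm' b ((hy b).2 ⟨hb, hPb⟩) with rfl | h'
  · exact hr.irrefl b hb hbm
  · exact hr.irrefl b hb (hr.trans b m b hb hmX hb hbm h')

/-- `A` is greedily built up to stage `s`: an element of `X` below `s` belongs to `A` if and only if
it is comparable, for inclusion, with all earlier elements of `A`. -/
def GreedyUpTo (r X A s : M) : Prop :=
  ∀ a, Mem a X → (PairMem r a s ∨ a = s) →
    (Mem a A ↔ ∀ b, Mem b A → Mem b X → PairMem r b a → Sub b a ∨ Sub a b)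

/-- The greedy rule at `a` consults only earlier elements, so induction along `r` applies. -/
theorem GreedyUpTo.agree (hU : ModelsZFCUR M) {r X : M} (hr : IsWellOrderOf r X) {A B s t : M}
    (hs : Mem s X) (ht : Mem t X) (hA : GreedyUpTo r X A s) (hB : GreedyUpTo r X B t) {a : M}
    (ha : Mem a X) (has : PairMem r a s ∨ a = s) (hat : PairMem r a t ∨ a = t) :
    Mem a A ↔ Mem a B := by
  refine hr.induction hU (fun a => (PairMem r a s ∨ a = s) → (PairMem r a t ∨ a = t) →
    (Mem a A ↔ Mem a B)) ?_ a ha has hat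
  intro a ha ih has hat
  rw [hA a ha has, hB a ha hat]
  have : ∀ b, Mem b X → PairMem r b a → (Mem b A ↔ Mem b B) := by
    intro b hb hba
    refine ih b hb hba (Or.inl ?_) (Or.inl ?_)
    · rcases has with h | rfl
      exacts [hr.trans b a s hb ha hs hba h, hba]
    · rcases hat with h | rfl
      exacts [hr.trans b a t hb ha ht hba h, hba]
  constructor
  · exact fun h b hb hbX hba => h b ((this b hbX hba).2 hb) hbX hba
  · exact fun h b hb hbX hba => h b ((this b hbX hba).1 hb) hbX hba

/-- The Hausdorff maximal principle: the greedy chain along a well-order of `X`. -/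
theorem exists_greedy (hU : ModelsZFCUR M) {r X : M} (hr : IsWellOrderOf r X) :
    ∃ C, Sub C X ∧ ∀ a, Mem a X →
      (Mem a C ↔ ∀ b, Mem b C → PairMem r b a → Sub b a ∨ Sub a b) := by
  have inst (E : Type u) [Ctx M E] (q q' : E → M) [Pr M q] [Pr M q'] :
      Dfn M fun e => GreedyUpTo r X (q e) (q' e) :=
    Dfn.comp₂ (inferInstanceAs (Dfn M fun p : M × M =>
      ∀ a, Mem a X → (PairMem r a p.2 ∨ a = p.2) →
    (Mem a p.1 ↔ ∀ b, Mem b p.1 → Mem b X → PairMem r b a → Sub b a ∨ Sub a b)))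
      inferInstance inferInstance
  -- Approximations agree wherever both are greedy, so they glue to `C` by Separation, in place of a
  -- recursion theorem.
  obtain ⟨C, -, hC⟩ := exists_sep hU (fun a => ∃ A, GreedyUpTo r X A a ∧ Mem a A) X
  have key : ∀ a, Mem a X → (∃ A, GreedyUpTo r X A a) →
      (Mem a C ↔ ∀ b, Mem b C → Mem b X → PairMem r b a → Sub b a ∨ Sub a b) := by
    rintro a ha ⟨A, hA⟩
    have hAC : ∀ b, Mem b X → (PairMem r b a ∨ b = a) → (Mem b A ↔ Mem b C) := by
      intro b hb hba
      have hAb : GreedyUpTo r X A b := by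
        intro c hc hcb
        refine hA c hc ?_
        rcases hba with hba | rfl
        · rcases hcb with hcb | rfl
          exacts [Or.inl (hr.trans c b a hc hb ha hcb hba), Or.inl hba]
        · exact hcb
      rw [hC]
      refine ⟨fun h => ⟨hb, A, hAb, h⟩, fun ⟨_, B, hB, hbB⟩ => ?_⟩
      exact (hAb.agree hU hr hb hb hB hb (Or.inr rfl) (Or.inr rfl)).2 hbB
    rw [← hAC a ha (Or.inr rfl), hA a ha (Or.inr rfl)]
    constructor
    · exact fun h b hb hbX hba => h b ((hAC b hbX (Or.inl hba)).2 hb) hbX hba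
    · exact fun h b hb hbX hba => h b ((hAC b hbX (Or.inl hba)).1 hb) hbX hba
  have ex : ∀ s, Mem s X → ∃ A, GreedyUpTo r X A s := by
    refine hr.induction hU _ fun s hs ih => ?_
    -- Below `s` the induction hypothesis makes `C` correct; the greedy rule decides `s` itself.
    obtain ⟨A, -, hA⟩ := exists_sep hU (fun a => PairMem r a s ∧ Mem a C ∨ a = s ∧
      ∀ b, Mem b C → Mem b X → PairMem r b s → Sub b a ∨ Sub a b) X
    have hA' : ∀ a, Mem a X → PairMem r a s → (Mem a A ↔ Mem a C) := by
      intro a ha has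
      rw [hA]
      have : a ≠ s := by rintro rfl; exact hr.irrefl a ha has
      tauto
    refine ⟨A, fun a ha has => ?_⟩
    have hlt : ∀ b, Mem b X → PairMem r b a → PairMem r b s := by
      intro b hb hba
      rcases has with h | rfl
      exacts [hr.trans b a s hb ha hs hba h, hba]
    trans ∀ b, Mem b C → Mem b X → PairMem r b a → Sub b a ∨ Sub a b
    · rcases has with has | rfl
      · rw [hA' a ha has, key a ha (ih a ha has)]
      · have := hr.irrefl a ha
        rw [hA]
        simp only [ha, this, true_and, false_and, false_or]
    · constructor
      · exact fun h b hb hbX hba => h b ((hA' b hbX (hlt b hbX hba)).1 hb) hbX hba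
      · exact fun h b hb hbX hba => h b ((hA' b hbX (hlt b hbX hba)).2 hb) hbX hba
  refine ⟨C, fun a ha => ((hC a).1 ha).1, fun a ha => (key a ha (ex a ha)).trans ?_⟩
  exact ⟨fun h b hb => h b hb ((hC b).1 hb).1, fun h b hb _ => h b hb⟩

end SetTheory

/-! ### Maximal ideals and ultrafilters inside the model -/

section Ultrafilter

variable {M : Type u} [lang.Structure M]

/-- `D` is a proper ideal of subsets of `w` that extends `J`. -/
structure IsIdealOver (J w D : M) : Prop where
  le : Sub J D
  ideal : ∀ s t i : M, Mem s D → Mem t D → IsSet i →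
    (∀ z : M, Mem z i → Mem z s ∨ Mem z t) → Mem i D
  proper : ¬ Mem w D

theorem IsIdealOver.mono {J w D s t : M} (hD : IsIdealOver J w D) (hs : Mem s D) (ht : IsSet t)
    (hts : Sub t s) : Mem t D :=
  hD.ideal s s t hs hs ht fun z hz => Or.inl (hts z hz)

/-- A proper ideal on a set extends to a maximal one. -/
theorem IsIdealOver.exists_maximal (hU : ModelsZFCUR M) {J w : M}
    (hJ : IsIdealOver J w J) (hJw : ∀ s, Mem s J → IsSet s ∧ Sub s w) (hne : ∃ s, Mem s J) :
    ∃ K, IsIdealOver J w K ∧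
      ∀ s, IsSet s → Sub s w → ¬ Mem s K → ∃ k, Mem k K ∧ ∀ z, Mem z w → Mem z k ∨ Mem z s := by
  obtain ⟨W, hW⟩ := hU.powerset w
  obtain ⟨Y, hY⟩ := hU.powerset W
  have : Dfn M fun D => IsIdealOver J w D := by
    have : Dfn M (Sub J) := Dfn.sub (s := fun _ => J) (t := fun D => D)
    have : Dfn M (Mem w) := Dfn.mem (s := fun _ => w) (t := fun D => D)
    refine Dfn.congr (fun D => Sub J D ∧ (∀ s t i : M, Mem s D → Mem t D → IsSet i →
      (∀ z : M, Mem z i → Mem z s ∨ Mem z t) → Mem i D) ∧ ¬ Mem w D) fun D =>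
      ⟨fun ⟨a, b, c⟩ => ⟨a, b, c⟩, fun ⟨a, b, c⟩ => ⟨a, b, c⟩⟩
  obtain ⟨X, hXs, hX⟩ := exists_sep hU (fun D => IsIdealOver J w D) Y
  obtain ⟨r, hr⟩ := hU.choice X hXs
  obtain ⟨C, hCX, hC⟩ := exists_greedy hU hr
  have chain : ∀ D E, Mem D C → Mem E C → Sub D E ∨ Sub E D := by
    intro D E hD hE
    rcases hr.total D E (hCX D hD) (hCX E hE) with h | rfl | h
    · exact (hC E (hCX E hE)).1 hE D hD h
    · exact Or.inl fun z hz => hz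
    · exact ((hC D (hCX D hD)).1 hD E hE h).symm
  have hCI : ∀ D, Mem D C → IsIdealOver J w D := fun D hD => ((hX D).1 (hCX D hD)).2
  have hJs : IsSet J := isSet_of_mem hU hne.choose_spec
  have hJX : Mem J X := (hX J).2 ⟨(hY J).2 ⟨hJs, fun s hs => (hW s).2
    (hJw s hs)⟩, hJ⟩
  -- `J` lies below every ideal in `X`, so the greedy chain never rejects it.
  have hJC : Mem J C := (hC J hJX).2 fun D hD _ => Or.inr (hCI D hD).le
  obtain ⟨K, hK⟩ := hU.union C
  have hKI : IsIdealOver J w K := by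
    refine ⟨fun s hs => (hK s).2 ⟨J, hJC, hs⟩, fun s t i hs ht hi h => ?_, fun h => ?_⟩
    · obtain ⟨D, hD, hs⟩ := (hK s).1 hs
      obtain ⟨E, hE, ht⟩ := (hK t).1 ht
      rcases chain D E hD hE with hDE | hED
      · exact (hK i).2 ⟨E, hE, (hCI E hE).ideal s t i (hDE s hs) ht hi h⟩
      · exact (hK i).2 ⟨D, hD, (hCI D hD).ideal s t i hs (hED t ht) hi h⟩
    · obtain ⟨D, hD, h⟩ := (hK w).1 h
      exact (hCI D hD).proper h
  refine ⟨K, hKI, fun s hs hsw hsK => ?_⟩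
  by_contra hc
  -- `L` is the ideal generated by `K` and `s`. It is proper by `hc` and contains every member of
  -- the chain, so it was itself admitted; this forces `s` into `K`.
  obtain ⟨L, hLs, hL⟩ := exists_sep hU
    (fun t => ∃ k, Mem k K ∧ ∀ z, Mem z t → Mem z k ∨ Mem z s) W
  have hKL : Sub K L := by
    intro t ht
    obtain ⟨D, hD, htD⟩ := (hK t).1 ht
    exact (hL t).2 ⟨((hY D).1 ((hX D).1 (hCX D hD)).1).2 t htD, t, ht, fun z hz => Or.inl hz⟩
  have hLI : IsIdealOver J w L := by
    refine ⟨fun t ht => hKL t (hKI.le t ht), fun t₁ t₂ i h₁ h₂ hi h => ?_, fun h => ?_⟩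
    · obtain ⟨hw₁, k₁, hk₁, h₁⟩ := (hL t₁).1 h₁
      obtain ⟨hw₂, k₂, hk₂, h₂⟩ := (hL t₂).1 h₂
      obtain ⟨k, hks, hk⟩ := exists_union₂ hU k₁ k₂
      refine (hL i).2 ⟨(hW i).2 ⟨hi, fun z hz => ?_⟩, k,
        hKI.ideal k₁ k₂ k hk₁ hk₂ hks fun z => (hk z).1, fun z hz => ?_⟩
      · rcases h z hz with h | h
        exacts [((hW t₁).1 hw₁).2 z h, ((hW t₂).1 hw₂).2 z h]
      · rw [hk]
        rcases h z hz with h | h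
        · rcases h₁ z h with h | h <;> tauto
        · rcases h₂ z h with h | h <;> tauto
    · exact hc ((hL w).1 h).2
  have hLX : Mem L X := (hX L).2 ⟨(hY L).2 ⟨hLs, fun t ht => ((hL t).1 ht).1⟩, hLI⟩
  have hLC : Mem L C := (hC L hLX).2 fun D hD _ =>
    Or.inl fun t ht => hKL t ((hK t).2 ⟨D, hD, ht⟩)
  obtain ⟨j, hj⟩ := hne
  exact hsK ((hK s).2 ⟨L, hLC, (hL s).2 ⟨(hW s).2 ⟨hs, hsw⟩, j, hKI.le j hj, fun z hz => Or.inr hz⟩⟩)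

/-- A proper ideal on a set is disjoint from some ultrafilter. -/
theorem IsIdealOver.exists_ultrafilter (hU : ModelsZFCUR M) {J w : M} (hw : IsSet w)
    (hJ : IsIdealOver J w J) (hJw : ∀ s, Mem s J → IsSet s ∧ Sub s w) (hne : ∃ s, Mem s J) :
    ∃ F, IsUltrafilterOn F w ∧ ∀ s, Mem s F → ¬ Mem s J := by
  obtain ⟨K, hK, hmax⟩ := hJ.exists_maximal hU hJw hne
  obtain ⟨W, hW⟩ := hU.powerset w
  -- Maximality of `K` makes it a prime ideal, so its complement is an ultrafilter.
  obtain ⟨F, hFs, hF⟩ := exists_sep hU (fun s => ¬ Mem s K) W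
  have hF' : ∀ s, Mem s F ↔ (IsSet s ∧ Sub s w) ∧ ¬ Mem s K := fun s => by rw [hF, hW]
  refine ⟨F, ⟨hw, hFs, fun s hs => ((hF' s).1 hs).1, ?_, ?_, ?_, ?_, ?_⟩,
    fun s hs hsJ => ((hF' s).1 hs).2 (hK.le s hsJ)⟩
  · exact (hF' w).2 ⟨⟨hw, fun z hz => hz⟩, hK.proper⟩
  · intro s hs
    by_contra! hc
    obtain ⟨j, hj⟩ := hne
    exact ((hF' s).1 hs).2
      (hK.mono (hK.le j hj) ((hF' s).1 hs).1.1 fun z hz => (hc z hz).elim)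
  · intro s t hs ht
    obtain ⟨⟨hss, hsw⟩, hsK⟩ := (hF' s).1 hs
    obtain ⟨⟨hts, htw⟩, htK⟩ := (hF' t).1 ht
    obtain ⟨i, his, hi⟩ := exists_sep hU (fun z => Mem z t) s
    refine ⟨i, (hF' i).2 ⟨⟨his, fun z hz => hsw z ((hi z).1 hz).1⟩, fun hiK => ?_⟩, hi⟩
    -- Since `w ⊆ k ∪ s`, also `t ⊆ k ∪ (s ∩ t)`, which would put `t` in `K`.
    obtain ⟨k, hk, hks⟩ := hmax s hss hsw hsK
    refine htK (hK.ideal k i t hk hiK hts fun z hz => ?_)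
    rw [hi]
    have := hks z (htw z hz)
    tauto
  · intro s t hs ht hst htw
    exact (hF' t).2 ⟨⟨ht, htw⟩, fun htK => ((hF' s).1 hs).2 (hK.mono htK ((hF' s).1 hs).1.1 hst)⟩
  · intro s hs hsw
    by_cases hsK : Mem s K
    · right
      obtain ⟨c, hcs, hc⟩ := exists_sep hU (fun z => ¬ Mem z s) w
      refine ⟨c, (hF' c).2 ⟨⟨hcs, fun z hz => ((hc z).1 hz).1⟩, fun hcK => ?_⟩, hc⟩
      exact hK.proper (hK.ideal s c w hsK hcK hw fun z hz => by rw [hc]; tauto)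
    · exact Or.inl ((hF' s).2 ⟨⟨hs, hsw⟩, hsK⟩)

end Ultrafilter

/-! ### Collection implies Łoś's theorem -/

section Los

variable {M : Type u} [lang.Structure M]

open Classical in
/-- The value `f(y)`, or `y` itself if `f` has no unique value at `y`. -/
noncomputable def val (f y : M) : M := if h : ∃! b, PairMem f y b then h.choose else y

theorem IsFunctionOn.pairMem_iff {f x y b : M} (hf : IsFunctionOn f x) (hy : Mem y x) :
    PairMem f y b ↔ b = val f y := by
  have h := hf.total y hy
  rw [val, dif_pos h]
  exact ⟨fun hb => h.choose_spec.2 b hb, fun hb => hb ▸ h.choose_spec.1⟩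

/-- The default value `y` keeps the graph definable for every `f`, function or not. -/
instance Tm.val (f : M) : Tm M fun y : M => val f y := by
  refine ⟨Dfn.congr (fun p : M × M => PairMem f p.1 p.2 ∧ (∃ b, PairMem f p.1 b ∧
    ∀ c, PairMem f p.1 c → c = b) ∨ ¬ (∃ b, PairMem f p.1 b ∧ ∀ c, PairMem f p.1 c → c = b) ∧
    p.2 = p.1) fun p => ?_⟩
  change PairMem f p.1 p.2 ∧ (∃! b, PairMem f p.1 b) ∨ ¬ (∃! b, PairMem f p.1 b) ∧ p.2 = p.1 ↔ _
  by_cases h : ∃! b, PairMem f p.1 b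
  · rw [Urelement.val, dif_pos h]
    simp only [h, and_true, not_true_eq_false, false_and, or_false]
    exact ⟨fun hb => h.choose_spec.2 _ hb, fun hb => hb ▸ h.choose_spec.1⟩
  · rw [Urelement.val, dif_neg h]
    simp only [h, and_false, not_false_eq_true, true_and, false_or]

section AlmostAll

variable {F x : M} {P Q : M → Prop}

theorem almostAll_congr (h : ∀ y, Mem y x → (P y ↔ Q y)) : AlmostAll F x P ↔ AlmostAll F x Q := by
  refine exists_congr fun s => and_congr_right fun _ => forall_congr' fun y => iff_congr Iff.rfl ?_
  exact and_congr_right fun hy => h y hy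

theorem AlmostAll.mono (hU : ModelsZFCUR M) (hF : IsUltrafilterOn F x) [Dfn M Q]
    (hP : AlmostAll F x P) (h : ∀ y, Mem y x → P y → Q y) : AlmostAll F x Q := by
  obtain ⟨s, hs, hsP⟩ := hP
  obtain ⟨t, ht, htQ⟩ := exists_sep hU Q x
  refine ⟨t, hF.upward s t hs ht (fun z hz => ?_) fun z hz => ((htQ z).1 hz).1, htQ⟩
  obtain ⟨hz, hPz⟩ := (hsP z).1 hz
  exact (htQ z).2 ⟨hz, h z hz hPz⟩

theorem AlmostAll.and (hF : IsUltrafilterOn F x) (hP : AlmostAll F x P) (hQ : AlmostAll F x Q) :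
    AlmostAll F x fun y => P y ∧ Q y := by
  obtain ⟨s, hs, hsP⟩ := hP
  obtain ⟨t, ht, htQ⟩ := hQ
  obtain ⟨i, hi, h⟩ := hF.inter s t hs ht
  exact ⟨i, hi, fun y => by rw [h, hsP, htQ]; tauto⟩

theorem AlmostAll.exists_mem (hF : IsUltrafilterOn F x) (hP : AlmostAll F x P) :
    ∃ y, Mem y x ∧ P y := by
  obtain ⟨s, hs, hsP⟩ := hP
  obtain ⟨y, hy⟩ := hF.nonempty s hs
  exact ⟨y, (hsP y).1 hy⟩

theorem almostAll_of_forall (hF : IsUltrafilterOn F x) (h : ∀ y, Mem y x → P y) :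
    AlmostAll F x P :=
  ⟨x, hF.base_mem, fun y => ⟨fun hy => ⟨hy, h y hy⟩, fun hy => hy.1⟩⟩

/-- `AlmostAll` also asserts that the set exists, so `P` must be definable before the ultrafilter
can decide it. -/
theorem almostAll_not (hU : ModelsZFCUR M) (hF : IsUltrafilterOn F x) [Dfn M P] :
    (AlmostAll F x fun y => ¬ P y) ↔ ¬ AlmostAll F x P := by
  constructor
  · intro h h'
    obtain ⟨y, -, hy, hy'⟩ := (h.and hF h').exists_mem hF
    exact hy hy'
  · intro h
    obtain ⟨s, hs, hsP⟩ := exists_sep hU P x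
    rcases hF.ultra s hs fun z hz => ((hsP z).1 hz).1 with hsF | ⟨c, hc, hcs⟩
    · exact (h ⟨s, hsF, hsP⟩).elim
    · exact ⟨c, hc, fun y => by rw [hcs, hsP]; tauto⟩

theorem almostAll_imp (hU : ModelsZFCUR M) (hF : IsUltrafilterOn F x) [Dfn M P] [Dfn M Q] :
    (AlmostAll F x fun y => P y → Q y) ↔ (AlmostAll F x P → AlmostAll F x Q) := by
  constructor
  · exact fun h hP => (h.and hF hP).mono hU hF fun y _ h => h.1 h.2
  · intro h
    by_cases hP : AlmostAll F x P
    · exact (h hP).mono hU hF fun y _ h _ => h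
    · exact ((almostAll_not hU hF).2 hP).mono hU hF fun y _ h h' => (h h').elim

end AlmostAll

variable {F x : M}

theorem eqMod_iff {f g : M} (hf : IsFunctionOn f x) (hg : IsFunctionOn g x) :
    EqMod F x f g ↔ AlmostAll F x fun y => val f y = val g y :=
  almostAll_congr fun y hy => by
    simp only [hf.pairMem_iff hy, hg.pairMem_iff hy]
    exact ⟨fun ⟨a, b, ha, hb, h⟩ => ha ▸ hb ▸ h, fun h => ⟨_, _, rfl, rfl, h⟩⟩

theorem Ultrapower.mk_eq_mk_iff (hU : ModelsZFCUR M) (hF : IsUltrafilterOn F x) {f g : M}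
    (hf : IsFunctionOn f x) (hg : IsFunctionOn g x) :
    mk F x f hf = mk F x g hg ↔ AlmostAll F x fun y => Urelement.val f y = Urelement.val g y := by
  constructor
  · intro h
    have h' : eqClass F x f = eqClass F x g := congrArg Subtype.val h
    have : f ∈ eqClass F x f := ⟨hf, (eqMod_iff hf hf).2 (almostAll_of_forall hF fun _ _ => rfl)⟩
    rw [h'] at this
    exact (eqMod_iff hf hg).1 this.2
  · refine fun h => Subtype.ext (Set.ext fun k => and_congr_right fun hk => ?_)
    rw [eqMod_iff hk hf, eqMod_iff hk hg]
    exact ⟨fun h' => (h.and hF h').mono hU hF fun y _ h => h.2.trans h.1,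
      fun h' => (h.and hF h').mono hU hF fun y _ h => h.2.trans h.1.symm⟩

/-- `MemHat` asks only for some representatives; any others agree with them on a member of `F`. -/
theorem Ultrapower.memHat_iff (hU : ModelsZFCUR M) (hF : IsUltrafilterOn F x) {g f : M}
    (hg : IsFunctionOn g x) (hf : IsFunctionOn f x) :
    MemHat (mk F x g hg) (mk F x f hf) ↔
      AlmostAll F x fun y => Mem (Urelement.val g y) (Urelement.val f y) := by
  have key : ∀ g f, IsFunctionOn g x → IsFunctionOn f x →
      ((AlmostAll F x fun y => ∃ a b : M, PairMem g y a ∧ PairMem f y b ∧ Mem a b) ↔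
        AlmostAll F x fun y => Mem (Urelement.val g y) (Urelement.val f y)) :=
    fun g f hg hf => almostAll_congr fun y hy => by
      simp only [hf.pairMem_iff hy, hg.pairMem_iff hy]
      exact ⟨fun ⟨a, b, ha, hb, h⟩ => ha ▸ hb ▸ h, fun h => ⟨_, _, rfl, rfl, h⟩⟩
  constructor
  · rintro ⟨g', f', hg', hf', h₁, h₂, h⟩
    rw [mk_eq_mk_iff hU hF] at h₁ h₂
    rw [key _ _ hg' hf'] at h
    exact ((h₁.and hF h₂).and hF h).mono hU hF fun y _ h => by rw [h.1.1, h.1.2]; exact h.2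
  · exact fun h => ⟨g, f, hg, hf, rfl, rfl, (key _ _ hg hf).2 h⟩

theorem Ultrapower.ureHat_iff (hU : ModelsZFCUR M) (hF : IsUltrafilterOn F x) {f : M}
    (hf : IsFunctionOn f x) :
    UreHat (mk F x f hf) ↔ AlmostAll F x fun y => Ure (Urelement.val f y) := by
  have key : ∀ f, IsFunctionOn f x → ((AlmostAll F x fun y => ∃ a : M, PairMem f y a ∧ Ure a) ↔
        AlmostAll F x fun y => Ure (Urelement.val f y)) :=
    fun f hf => almostAll_congr fun y hy => by
      simp only [hf.pairMem_iff hy, exists_eq_left]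
  constructor
  · rintro ⟨f', hf', h₁, h⟩
    rw [mk_eq_mk_iff hU hF] at h₁
    rw [key _ hf'] at h
    exact (h₁.and hF h).mono hU hF fun y _ h => by rw [h.1]; exact h.2
  · exact fun h => ⟨f, hf, rfl, (key _ hf).2 h⟩

/-- Under Collection, every definable relation on a set has a choice function. -/
theorem SatisfiesCollection.exists_selector (hU : ModelsZFCUR M) (hC : SatisfiesCollection M)
    {R : M → M → Prop} (hR : Dfn M fun p : M × M => R p.1 p.2) (x : M) :
    ∃ f, IsFunctionOn f x ∧ ∀ y, Mem y x → (∃ a, R y a) → R y (val f y) := by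
  -- Made total, so that indices without a witness do not block Collection.
  let R' : M → M → Prop := fun y a => (∃ b, R y b) → R y a
  have hR' : Dfn M fun p : M × M => R' p.1 p.2 := by
    have : Dfn M fun p : (M × M) × M => R p.1.1 p.2 :=
      hR.comp _ (hq := Pr.pair (fun p : (M × M) × M => p.1.1) fun p => p.2)
    exact Dfn.imp (M := M)
  obtain ⟨v₀, hv₀⟩ := hC.exists_collecting hR' (w := x) fun y _ => by
    by_cases h : ∃ b, R y b
    · obtain ⟨b, hb⟩ := h
      exact ⟨b, fun _ => hb⟩
    · exact ⟨y, fun h' => (h h').elim⟩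
  -- AC well-orders sets only, and `v₀` might be an urelement.
  obtain ⟨v, hvs, hv⟩ := exists_sep hU (fun _ => True) v₀
  obtain ⟨r, hr⟩ := hU.choice v hvs
  have hT : Dfn M fun p : M × M => (Mem p.2 v ∧ R' p.1 p.2) ∧
      ∀ c, Mem c v ∧ R' p.1 c → c = p.2 ∨ PairMem r p.2 c := by
    have : Dfn M fun p : (M × M) × M => R' p.1.1 p.2 :=
      hR'.comp _ (hq := Pr.pair (fun p : (M × M) × M => p.1.1) fun p => p.2)
    infer_instance
  obtain ⟨f, hf, hf'⟩ := exists_function hU (x := x) (R := fun y b => (Mem b v ∧ R' y b) ∧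
      ∀ c, Mem c v ∧ R' y c → c = b ∨ PairMem r b c) hT fun y hy => by
    have : Dfn M fun a => R' y a := by
      have := Dfn.comp₂ hR' (Tm.const (E := M) y) (Tm.var (M := M) fun a : M => a)
      exact this
    obtain ⟨s, -, hs⟩ := exists_sep hU (fun a => R' y a) v
    obtain ⟨a, ha, haR⟩ := hv₀ y hy
    obtain ⟨m, hm, hmin⟩ := hr.least s (fun z hz => ((hs z).1 hz).1)
      ⟨a, (hs a).2 ⟨(hv a).2 ⟨ha, trivial⟩, haR⟩⟩
    have hm' := (hs m).1 hm
    refine ⟨m, ⟨hm', fun c hc => hmin c ((hs c).2 hc)⟩, fun b ⟨hb, hb'⟩ => ?_⟩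
    rcases hmin b ((hs b).2 hb) with h | h
    · exact h
    · rcases hb' m hm' with h' | h'
      · exact h'.symm
      · exact (hr.irrefl m hm'.1 (hr.trans m b m hm'.1 hb.1 hm'.1 h h')).elim
  refine ⟨f, hf, fun y hy hex => ?_⟩
  exact ((hf' y _ hy).1 ((hf.pairMem_iff hy).2 rfl)).1.2 hex

/-- Łoś's theorem under Collection, for formulas with bound variables. -/
theorem realize_ultrapower_iff (hU : ModelsZFCUR M) (hC : SatisfiesCollection M)
    (hF : IsUltrafilterOn F x) {n k : ℕ} (φ : lang.BoundedFormula (Fin n) k)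
    (f : Fin n → {f // IsFunctionOn f x}) (g : Fin k → {f // IsFunctionOn f x}) :
    φ.Realize (fun i => Ultrapower.mk F x (f i).1 (f i).2)
        (fun i => Ultrapower.mk F x (g i).1 (g i).2) ↔
      AlmostAll F x fun y => φ.Realize (fun i => val (f i).1 y) fun i => val (g i).1 y := by
  have hterm : ∀ {k : ℕ} (g : Fin k → {f // IsFunctionOn f x}) (τ : lang.Term (Fin n ⊕ Fin k)),
      ∃ h : {f // IsFunctionOn f x},
        τ.realize (Sum.elim (fun i => Ultrapower.mk F x (f i).1 (f i).2)
          fun i => Ultrapower.mk F x (g i).1 (g i).2) = Ultrapower.mk F x h.1 h.2 ∧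
        ∀ y, τ.realize (Sum.elim (fun i => val (f i).1 y) fun i => val (g i).1 y) = val h.1 y := by
    rintro k g ((i | i) | e)
    exacts [⟨f i, rfl, fun _ => rfl⟩, ⟨g i, rfl, fun _ => rfl⟩, e.elim]
  have hdfn : ∀ {k : ℕ} (g : Fin k → {f // IsFunctionOn f x}) (φ : lang.BoundedFormula (Fin n) k),
      Dfn M fun y => φ.Realize (fun i => val (f i).1 y) fun i => val (g i).1 y :=
    fun g φ => Dfn.boundedFormula_realize φ _ _ (fun _ => inferInstance) fun _ => inferInstance
  induction φ with
  | falsum => exact ⟨False.elim, fun h => (h.exists_mem hF).choose_spec.2⟩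
  | equal t₁ t₂ =>
    obtain ⟨h₁, e₁, e₁'⟩ := hterm g t₁
    obtain ⟨h₂, e₂, e₂'⟩ := hterm g t₂
    simp only [Language.BoundedFormula.Realize, e₁, e₂, e₁', e₂']
    exact Ultrapower.mk_eq_mk_iff hU hF h₁.2 h₂.2
  | rel R ts =>
    cases R with
    | mem =>
      obtain ⟨h₁, e₁, e₁'⟩ := hterm g (ts 0)
      obtain ⟨h₂, e₂, e₂'⟩ := hterm g (ts 1)
      refine Iff.trans ?_ ((Ultrapower.memHat_iff hU hF h₁.2 h₂.2).trans ?_)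
      · rw [← e₁, ← e₂]
        rfl
      · refine almostAll_congr fun y _ => ?_
        rw [← e₁', ← e₂', Mem]
        refine iff_of_eq (congrArg _ (funext fun i => ?_))
        fin_cases i <;> rfl
    | ure =>
      obtain ⟨h₁, e₁, e₁'⟩ := hterm g (ts 0)
      refine Iff.trans ?_ ((Ultrapower.ureHat_iff hU hF h₁.2).trans ?_)
      · rw [← e₁]
        rfl
      · refine almostAll_congr fun y _ => ?_
        rw [← e₁', Ure]
        refine iff_of_eq (congrArg _ (funext fun i => ?_))
        fin_cases i; rfl
  | imp φ ψ h₁ h₂ =>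
    have := hdfn g φ
    have := hdfn g ψ
    exact (imp_congr (h₁ g) (h₂ g)).trans (almostAll_imp hU hF).symm
  | all φ ih =>
    rename_i k
    have hφ : ∀ h : {f // IsFunctionOn f x},
        φ.Realize (fun i => Ultrapower.mk F x (f i).1 (f i).2)
          (Fin.snoc (fun i => Ultrapower.mk F x (g i).1 (g i).2) (Ultrapower.mk F x h.1 h.2)) ↔
        AlmostAll F x fun y => φ.Realize (fun i => val (f i).1 y)
          (Fin.snoc (fun i => val (g i).1 y) (val h.1 y)) := by
      intro h
      have e : ∀ {β : Type u} (m : {f // IsFunctionOn f x} → β),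
          (Fin.snoc (fun i => m (g i)) (m h) : Fin (k + 1) → β) =
            fun i => m ((Fin.snoc g h : Fin (k + 1) → {f // IsFunctionOn f x}) i) :=
        fun m => (Fin.comp_snoc m g h).symm
      rw [e fun h => Ultrapower.mk F x h.1 h.2]
      refine (ih _).trans ?_
      exact almostAll_congr fun y _ => by rw [e fun h => val h.1 y]
    rw [Language.BoundedFormula.realize_all]
    constructor
    · intro H
      have hA := hdfn g φ.all
      have hR : Dfn M fun p : M × M => ¬ φ.Realize (fun i => val (f i).1 p.1)
          (Fin.snoc (fun i => val (g i).1 p.1) p.2) := by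
        have := Dfn.boundedFormula_realize φ (fun (p : M × M) i => val (f i).1 p.1)
          (fun p => Fin.snoc (fun i => val (g i).1 p.1) p.2) (fun i => inferInstance) fun i => by
            refine Fin.lastCases ?_ (fun j => ?_) i
            · simp only [Fin.snoc_last]; infer_instance
            · simp only [Fin.snoc_castSucc]; infer_instance
        exact Dfn.not (M := M)
      -- `h` picks a counterexample wherever one exists, so `φ` at `h y` already implies the
      -- universal statement at `y`.
      obtain ⟨h, hh, hsel⟩ := hC.exists_selector hU
        (R := fun y a => ¬ φ.Realize (fun i => val (f i).1 y)
          (Fin.snoc (fun i => val (g i).1 y) a)) hR x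
      refine AlmostAll.mono hU hF ((hφ ⟨h, hh⟩).1 (H _)) fun y hy hy' => ?_
      rw [Language.BoundedFormula.realize_all]
      by_contra! hc
      exact hsel y hy hc hy'
    · rintro H ⟨c, h, hh, rfl⟩
      refine (hφ ⟨h, hh⟩).2 ?_
      have : Dfn M fun y => φ.Realize (fun i => val (f i).1 y)
          (Fin.snoc (fun i => val (g i).1 y) (val h y)) := by
        refine Dfn.boundedFormula_realize φ _ _ (fun i => inferInstance) fun i => ?_
        refine Fin.lastCases ?_ (fun j => ?_) i
        · simp only [Fin.snoc_last]; infer_instance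
        · simp only [Fin.snoc_castSucc]; infer_instance
      exact H.mono hU hF fun y _ hy => hy (val h y)

theorem SatisfiesCollection.losHolds (hU : ModelsZFCUR M) (hC : SatisfiesCollection M)
    (hF : IsUltrafilterOn F x) : LosHolds F x := by
  intro n φ f hf
  refine Iff.trans ?_ ((realize_ultrapower_iff hU hC hF φ (fun i => ⟨f i, hf i⟩)
    finZeroElim).trans ?_)
  · exact iff_of_eq (congrArg _ (funext finZeroElim))
  · refine almostAll_congr fun y hy => ?_
    have : ∀ v : Fin n → M, (∀ i, PairMem (f i) y (v i)) ↔ v = fun i => val (f i) y := fun v => by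
      simp only [(hf _).pairMem_iff hy, funext_iff]
    simp only [this, exists_eq_left]
    exact iff_of_eq (congrArg _ (funext finZeroElim))

end Los

/-! ### Łoś's theorem implies Collection -/

section Collection

variable {M : Type u} [lang.Structure M]

/-- If Łoś's theorem holds for `M/F` then every definable relation that is total on the base of `F`
is collected on a member of `F`. -/
theorem LosHolds.exists_collecting (hU : ModelsZFCUR M) {F w : M} (hF : IsUltrafilterOn F w)
    (hL : LosHolds F w) {n : ℕ} (φ : lang.Formula (Fin (n + 2))) (u : Fin n → M)
    (h : ∀ x : M, Mem x w →
      ∃ y : M, φ.Realize (Fin.cons x (Fin.cons y u : Fin (n + 1) → M) : Fin (n + 2) → M)) :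
    ∃ s v, Mem s F ∧ ∀ x, Mem x s → ∃ y, Mem y v ∧
      φ.Realize (Fin.cons x (Fin.cons y u : Fin (n + 1) → M) : Fin (n + 2) → M) := by
  obtain ⟨i, hi, hi'⟩ := exists_function hU (R := fun a b => b = a) inferInstance (x := w)
    fun a _ => ⟨a, rfl, fun _ h => h⟩
  have hc : ∀ c : M, ∃ f, IsFunctionOn f w ∧ ∀ a b, Mem a w → (PairMem f a b ↔ b = c) := fun c =>
    exists_function hU (R := fun _ b => b = c) inferInstance fun _ _ => ⟨c, rfl, fun _ h => h⟩
  choose k hk hk' using hc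
  let ψ : lang.Formula (Fin (n + 1)) := Language.Formula.iExs (α := Fin (n + 1)) Unit
    (φ.relabel (Fin.cons (Sum.inl 0) (Fin.cons (Sum.inr ()) fun j => Sum.inl j.succ :
      Fin (n + 1) → Fin (n + 1) ⊕ Unit) : Fin (n + 2) → Fin (n + 1) ⊕ Unit))
  -- Stated for all structures because it is used both in `M` and in the ultrapower.
  have hψ : ∀ (N : Type u) [lang.Structure N] (a : N) (b : Fin n → N),
      ψ.Realize (Fin.cons a b : Fin (n + 1) → N) ↔ ∃ y : N,
        φ.Realize (Fin.cons a (Fin.cons y b : Fin (n + 1) → N) : Fin (n + 2) → N) := by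
    intro N _ a b
    have e : ∀ z : Unit → N, (Sum.elim (Fin.cons a b : Fin (n + 1) → N) z ∘
        (Fin.cons (Sum.inl 0) (Fin.cons (Sum.inr ()) fun j => Sum.inl j.succ :
        Fin (n + 1) → Fin (n + 1) ⊕ Unit) : Fin (n + 2) → Fin (n + 1) ⊕ Unit)) =
        (Fin.cons a (Fin.cons (z ()) b : Fin (n + 1) → N) : Fin (n + 2) → N) := by
      intro z
      funext j
      refine Fin.cases rfl (fun j => ?_) j
      refine Fin.cases rfl (fun j => rfl) j
    rw [Language.Formula.realize_iExs]
    simp only [Language.Formula.realize_relabel, e]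
    exact ⟨fun ⟨z, hz⟩ => ⟨z (), hz⟩, fun ⟨y, hy⟩ => ⟨fun _ => y, hy⟩⟩
  have hmk : ∀ {m : ℕ} (f : M) (g : Fin m → M) (hf : IsFunctionOn f w)
      (hg : ∀ j, IsFunctionOn (g j) w)
      (hfg : ∀ j, IsFunctionOn ((Fin.cons f g : Fin (m + 1) → M) j) w),
      (fun j => Ultrapower.mk F w ((Fin.cons f g : Fin (m + 1) → M) j) (hfg j)) =
        (Fin.cons (Ultrapower.mk F w f hf) fun j => Ultrapower.mk F w (g j) (hg j) :
          Fin (m + 1) → Ultrapower F w) := by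
    intro m f g hf hg hfg
    funext j
    refine Fin.cases rfl (fun j => rfl) j
  have hcons : ∀ {m : ℕ} {f : M} {g : Fin m → M} (_ : IsFunctionOn f w)
      (_ : ∀ j, IsFunctionOn (g j) w) (j), IsFunctionOn ((Fin.cons f g : Fin (m + 1) → M) j) w :=
    fun hf hg j => Fin.cases hf hg j
  have hku := fun j => hk (u j)
  have h₁ := (hL (n + 1) ψ (Fin.cons i fun j => k (u j)) (hcons hi hku)).2 <|
    almostAll_of_forall hF fun y hy => ⟨Fin.cons y u, fun j => by
      refine Fin.cases ?_ (fun j => ?_) j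
      · exact (hi' y y hy).2 rfl
      · exact (hk' (u j) y (u j) hy).2 rfl, (hψ M y u).2 (h y hy)⟩
  rw [hmk i _ hi hku, hψ] at h₁
  -- A witness in the ultrapower is the class of a function `g` of the model, whose range bounds the
  -- values `g y`.
  obtain ⟨⟨c, g, hg, rfl⟩, h₁⟩ := h₁
  have h₂ := (hL (n + 2) φ (Fin.cons i (Fin.cons g fun j => k (u j)))
    (hcons hi (hcons hg hku))).1 (by
      rw [hmk i _ hi (hcons hg hku), hmk g _ hg hku]
      exact h₁)
  obtain ⟨s, hs, hs'⟩ := h₂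
  obtain ⟨v, hv⟩ := exists_range hU g
  refine ⟨s, v, hs, fun y hy => ?_⟩
  obtain ⟨hyw, a, ha, hφ⟩ := (hs' y).1 hy
  refine ⟨a 1, hv y _ (ha 1), ?_⟩
  convert hφ
  funext j
  refine Fin.cases ?_ (fun j => ?_) j
  · exact ((hi' y _ hyw).1 (ha 0)).symm
  · refine Fin.cases rfl (fun j => ?_) j
    exact ((hk' (u j) y _ hyw).1 (ha j.succ.succ)).symm

theorem satisfiesCollection_of_losHolds (hU : ModelsZFCUR M)
    (hL : ∀ F x : M, IsUltrafilterOn F x → LosHolds F x) : SatisfiesCollection M := by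
  intro n φ w u h
  by_contra hc
  have hw : IsSet w := by
    by_contra hw
    exact hc ⟨w, fun x hx => (hw (isSet_of_mem hU hx)).elim⟩
  let R : M → M → Prop := fun x y =>
    φ.Realize (Fin.cons x (Fin.cons y u : Fin (n + 1) → M) : Fin (n + 2) → M)
  have hR : ∀ (E : Type u) [Ctx M E] (s t : E → M) [Tm M s] [Tm M t],
      Dfn M fun e => R (s e) (t e) := fun E _ s t _ _ =>
    Dfn.boundedFormula_realize φ
      (fun e => (Fin.cons (s e) (Fin.cons (t e) u : Fin (n + 1) → M) : Fin (n + 2) → M))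
      (fun _ => default) (fun j => by
        refine Fin.cases ‹_› (fun j => ?_) j
        exact Fin.cases ‹_› (fun j => inferInstanceAs (Tm M fun _ => u j)) j) finZeroElim
  obtain ⟨W, hW⟩ := hU.powerset w
  -- An ideal because two collecting sets have a union; proper because Collection fails on `w`.
  obtain ⟨J, -, hJ⟩ := exists_sep hU
    (fun s => ∃ v, ∀ x, Mem x s → ∃ y, Mem y v ∧ R x y) W
  have hJI : IsIdealOver J w J := by
    refine ⟨fun _ hs => hs, fun s t i hs ht hi hist => ?_, fun hwJ => hc ((hJ w).1 hwJ).2⟩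
    obtain ⟨hs, a, ha⟩ := (hJ s).1 hs
    obtain ⟨ht, b, hb⟩ := (hJ t).1 ht
    obtain ⟨v, -, hv⟩ := exists_union₂ hU a b
    refine (hJ i).2 ⟨(hW i).2 ⟨hi, fun z hz => ?_⟩, v, fun x hx => ?_⟩
    · rcases hist z hz with h | h
      exacts [((hW s).1 hs).2 z h, ((hW t).1 ht).2 z h]
    · rcases hist x hx with h | h
      · obtain ⟨y, hy, hxy⟩ := ha x h
        exact ⟨y, (hv y).2 (Or.inl hy), hxy⟩
      · obtain ⟨y, hy, hxy⟩ := hb x h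
        exact ⟨y, (hv y).2 (Or.inr hy), hxy⟩
  obtain ⟨e, he, he'⟩ := exists_empty hU
  obtain ⟨F, hF, hFJ⟩ := hJI.exists_ultrafilter hU hw (fun s hs => (hW s).1 ((hJ s).1 hs).1)
    ⟨e, (hJ e).2 ⟨(hW e).2 ⟨he, fun z hz => (he' z hz).elim⟩, e, fun x hx => (he' x hx).elim⟩⟩
  obtain ⟨s, v, hs, hv⟩ := (hL F w hF).exists_collecting hU hF φ u h
  exact hFJ s hs ((hJ s).2 ⟨(hW s).2 (hF.subset s hs), v, hv⟩)

end Collection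

end Urelement

theorem mainTheorem2 (U : Type*) [Urelement.lang.Structure U]
    (hU : Urelement.ModelsZFCUR U) :
    (∀ F x : U, Urelement.IsUltrafilterOn F x → Urelement.LosHolds F x) ↔
      Urelement.SatisfiesCollection U :=
  ⟨Urelement.satisfiesCollection_of_losHolds hU, fun hC _ _ hF => hC.losHolds hU hF⟩
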